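/- Let $\beta>1$ be a real number and $I=[0,1)$. Let $T_\beta\colon I\to I$, $T_\beta(x)=\beta x-\lfloor\beta x\rfloor$, be the $\beta$-transformation, and for $x\in I$ and $n\ge1$ let $\varepsilon_n(x,\beta)=\lfloor\beta T_\beta^{n-1}(x)\rfloor$ be the $n$-th digit of $x$ in base $\beta$. For $y\in I$ let \[I_n(y)=\{z\in I\colon \varepsilon_i(z,\beta)=\varepsilon_i(y,\beta)\text{ for }1\le i\le n\}\] be the basic interval of order $n$ containing $y$, and for $x,y\in I$ let \[W_n^\beta(x,y)=\inf\{k\ge1\colon T_\beta^kx\in I_n(y)\}\in\{1,2,\dots\}\cup\{\infty\}\] be the waiting time (with $\inf\emptyset=\infty$ and $\log\infty=\infty$). Define the lower and upper quantitative waiting time indicators \[\underline R^\beta(x,y)=\liminf_{n\to\infty}\frac{\log W_n^\beta(x,y)}{n},\qquad \overline R^\beta(x,y)=\limsup_{n\to\infty}\frac{\log W_n^\beta(x,y)}{n}\] in $[0,\infty]$. Then, for all $0\le a\le b\le\infty$, the set \[E_\beta(a,b)=\{(x,y)\in I^2\colon \underline R^\beta(x,y)=a,\ \overline R^\beta(x,y)=b\}\]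 has Hausdorff dimension $2$. -/

import Mathlib

noncomputable section

namespace BetaWaiting

/-- The `β`-transformation `x ↦ βx - ⌊βx⌋` (it maps `[0,1)` into itself). -/
def betaMap (β x : ℝ) : ℝ := β * x - ⌊β * x⌋

/-- The `n`-th digit (`n ≥ 1`) of `x` in base `β`: the integer part of `β T^{n-1} x`. -/
def digit (β x : ℝ) (n : ℕ) : ℤ := ⌊β * (betaMap β)^[n - 1] x⌋

/-- The basic interval `I_n(y)` of order `n` containing `y`: the points of `[0,1)` whose first
`n` digits are those of `y`. -/
def basicInterval (β : ℝ) (n : ℕ) (y : ℝ) : Set ℝ :=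
  {z | z ∈ Set.Ico (0 : ℝ) 1 ∧ ∀ i, 1 ≤ i → i ≤ n → digit β z i = digit β y i}

/-- The waiting time `inf {k ≥ 1 : T^k x ∈ I_n(y)}`; it is `⊤` if there is no such `k`. -/
def waitingTime (β : ℝ) (n : ℕ) (x y : ℝ) : ℕ∞ :=
  ⨅ (k : ℕ) (_ : 1 ≤ k ∧ (betaMap β)^[k] x ∈ basicInterval β n y), (k : ℕ∞)

/-- `log W_n(x,y) / n`, as an extended real (`log ∞ = ∞`). -/
def waitingRate (β x y : ℝ) (n : ℕ) : EReal :=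
  ENNReal.log (waitingTime β n x y : ENNReal) / (n : EReal)

/-- The lower quantitative waiting time indicator. If some `W_n(x,y)` is infinite, then so are
all later ones, hence this is `⊤`, and the same holds for the upper indicator. -/
def lowerIndicator (β x y : ℝ) : EReal :=
  Filter.liminf (waitingRate β x y) Filter.atTop

/-- The upper quantitative waiting time indicator. -/
def upperIndicator (β x y : ℝ) : EReal :=
  Filter.limsup (waitingRate β x y) Filter.atTop

/-- The planar waiting set `E_β(a,b)`. The product metric of `ℝ × ℝ` is bi-Lipschitz equivalent
to the Euclidean one, so that it gives the same Hausdorff dimensions. -/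
def waitingSet (β : ℝ) (a b : EReal) : Set (ℝ × ℝ) :=
  {p | p.1 ∈ Set.Ico (0 : ℝ) 1 ∧ p.2 ∈ Set.Ico (0 : ℝ) 1 ∧
    lowerIndicator β p.1 p.2 = a ∧ upperIndicator β p.1 p.2 = b}

end BetaWaiting

end

/-!
Full cylinders, those mapped onto `[0, 1)`, can be concatenated freely, and a counting argument
shows that for large `m` the admissible words of length `m` with full cylinders form an alphabet
of about `β ^ m` letters. Take an arbitrary word `η` and let `y` be given by `η` preceded by two
zero letters, a pattern that `η` does not contain. Let `x` be given by another arbitrary word `ξ`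
into which the first `n + 3` letters of `y`, followed by a letter that breaks the agreement, are
inserted at the place `Q n`. As the pattern marks the insertions, `x` meets the first `n + 3`
letters of `y` for the first time at the place `Q n`; so the two indicators are the lower and upper
exponential growth rates of `Q` divided by `m`, and these are arbitrary. The insertions are sparse,
so the map from `(x, y)` back to `(ξ, η)`, read as a point of the unit square in base the number of
letters, is Hölder with exponent close to `1`. Its image is the whole square, of dimension `2`.
-/

noncomputable section

namespace BetaWaiting

open Set Filter Topology

variable {β : ℝ} {x y z : ℝ} {k m n : ℕ}

theorem betaMap_mem_Ico (β x : ℝ) : betaMap β x ∈ Ico (0 : ℝ) 1 :=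
  ⟨Int.fract_nonneg _, Int.fract_lt_one _⟩

theorem iterate_betaMap_mem_Ico (hx : x ∈ Ico (0 : ℝ) 1) (k : ℕ) :
    (betaMap β)^[k] x ∈ Ico (0 : ℝ) 1 := by
  cases k with
  | zero => exact hx
  | succ k =>
    rw [Function.iterate_succ_apply']
    exact betaMap_mem_Ico β _

theorem iterate_betaMap_zero (β : ℝ) (k : ℕ) : (betaMap β)^[k] 0 = 0 :=
  Function.iterate_fixed (by simp [betaMap]) k

theorem betaMap_add_div (hβ : β ≠ 0) (d : ℤ) (hx : x ∈ Ico (0 : ℝ) 1) :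
    betaMap β ((d + x) / β) = x := by
  rw [betaMap, mul_div_cancel₀ _ hβ, Int.floor_intCast_add, Int.floor_eq_zero_iff.2 hx]
  simp

theorem digit_iterate (β x : ℝ) (k i : ℕ) :
    digit β ((betaMap β)^[k] x) (i + 1) = digit β x (k + i + 1) := by
  simp only [digit, Nat.add_sub_cancel, ← Function.iterate_add_apply, add_comm i k]

theorem mem_basicInterval_iff :
    z ∈ basicInterval β n y ↔
      z ∈ Ico (0 : ℝ) 1 ∧ ∀ i < n, digit β z (i + 1) = digit β y (i + 1) := by
  refine and_congr_right fun _ => ⟨fun h i hi => h (i + 1) (by omega) hi, fun h i hi hin => ?_⟩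
  obtain ⟨i, rfl⟩ := Nat.exists_eq_add_of_le' hi
  exact h i hin

theorem mem_basicInterval_self (n : ℕ) (hx : x ∈ Ico (0 : ℝ) 1) : x ∈ basicInterval β n x :=
  ⟨hx, fun _ _ _ => rfl⟩

theorem mem_basicInterval_symm (hy : y ∈ Ico (0 : ℝ) 1) (h : z ∈ basicInterval β n y) :
    y ∈ basicInterval β n z :=
  ⟨hy, fun i hi hin => (h.2 i hi hin).symm⟩

theorem mem_basicInterval_trans (hz : z ∈ basicInterval β n y) (hy : y ∈ basicInterval β n x) :
    z ∈ basicInterval β n x :=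
  ⟨hz.1, fun i hi hin => (hz.2 i hi hin).trans (hy.2 i hi hin)⟩

theorem basicInterval_antitone (β y : ℝ) : Antitone fun n => basicInterval β n y :=
  fun _ _ hmn _ hz => ⟨hz.1, fun i hi hin => hz.2 i hi (hin.trans hmn)⟩

theorem mem_basicInterval_add :
    z ∈ basicInterval β (m + n) y ↔
      z ∈ basicInterval β m y ∧ (betaMap β)^[m] z ∈ basicInterval β n ((betaMap β)^[m] y) := by
  simp only [mem_basicInterval_iff, digit_iterate]
  refine ⟨fun h => ⟨⟨h.1, fun i hi => h.2 i (by omega)⟩, iterate_betaMap_mem_Ico h.1 m,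
    fun i hi => h.2 (m + i) (by omega)⟩, fun h => ⟨h.1.1, fun i hi => ?_⟩⟩
  rcases lt_or_ge i m with him | hmi
  · exact h.1.2 i him
  · obtain ⟨j, rfl⟩ := Nat.exists_eq_add_of_le hmi
    exact h.2.2 j (by omega)

theorem iterate_sub_iterate (h : z ∈ basicInterval β n y) :
    (betaMap β)^[n] z - (betaMap β)^[n] y = β ^ n * (z - y) := by
  induction n with
  | zero => simp
  | succ n ih =>
    have hdigit : ⌊β * (betaMap β)^[n] z⌋ = ⌊β * (betaMap β)^[n] y⌋ :=
      (mem_basicInterval_iff.1 h).2 n n.lt_succ_self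
    rw [Function.iterate_succ_apply', Function.iterate_succ_apply', betaMap, betaMap, hdigit,
      pow_succ', mul_assoc, ← ih (basicInterval_antitone β y n.le_succ h)]
    ring

theorem digit_le_digit (hβ : 0 ≤ β) (hx : x ∈ basicInterval β n y) (hz : z ∈ basicInterval β n y)
    (hxz : x ≤ z) : digit β x (n + 1) ≤ digit β z (n + 1) := by
  refine Int.floor_mono (mul_le_mul_of_nonneg_left ?_ hβ)
  rw [Nat.add_sub_cancel, ← sub_le_sub_iff_right ((betaMap β)^[n] y), iterate_sub_iterate hx,
    iterate_sub_iterate hz]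
  gcongr

theorem ordConnected_basicInterval (hβ : 0 ≤ β) (n : ℕ) (y : ℝ) :
    (basicInterval β n y).OrdConnected := by
  induction n with
  | zero =>
    have : basicInterval β 0 y = Ico (0 : ℝ) 1 := by
      ext z
      simp [mem_basicInterval_iff]
    exact this ▸ ordConnected_Ico
  | succ n ih =>
    refine ⟨fun u hu v hv w hw => ?_⟩
    have hu' := basicInterval_antitone β y n.le_succ hu
    have hv' := basicInterval_antitone β y n.le_succ hv
    have hw' := ih.out hu' hv' hw
    refine ⟨hw'.1, fun i hi hin => ?_⟩
    rcases hin.lt_or_eq with hin | rfl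
    · exact hw'.2 i hi (Nat.le_of_lt_succ hin)
    · exact le_antisymm ((digit_le_digit hβ hw' hv' hw.2).trans (hv.2 _ hi le_rfl).le)
        ((hu.2 _ hi le_rfl).ge.trans (digit_le_digit hβ hu' hw' hw.1))

/-- `c` is the left endpoint of a full basic interval of order `n`, that is, of one of the maximal
possible length `β⁻ⁿ`. -/
def IsFull (β : ℝ) (n : ℕ) (c : ℝ) : Prop :=
  Ico c (c + (β ^ n)⁻¹) ⊆ basicInterval β n c

section IsFull

variable {c d : ℝ}

theorem IsFull.self_mem (hβ : 0 < β) (h : IsFull β n c) : c ∈ basicInterval β n c :=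
  h (left_mem_Ico.2 (lt_add_of_pos_right c (by positivity)))

theorem IsFull.mem_Ico (hβ : 0 < β) (h : IsFull β n c) : c ∈ Ico (0 : ℝ) 1 :=
  (h.self_mem hβ).1

theorem IsFull.add_le_one (hβ : 0 < β) (h : IsFull β n c) : c + (β ^ n)⁻¹ ≤ 1 := by
  by_contra! hlt
  exact lt_irrefl (1 : ℝ) (h ⟨(h.mem_Ico hβ).2.le, hlt⟩).1.2

theorem IsFull.add_div_mem (hβ : 0 < β) (h : IsFull β n c) (hx : x ∈ Ico (0 : ℝ) 1) :
    c + x / β ^ n ∈ basicInterval β n c := by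
  have hpos : 0 < β ^ n := by positivity
  refine h ⟨le_add_of_nonneg_right (div_nonneg hx.1 hpos.le), ?_⟩
  rw [div_eq_mul_inv]
  gcongr
  exact mul_lt_of_lt_one_left (by positivity) hx.2

theorem IsFull.iterate_eq_zero (hβ : 0 < β) (h : IsFull β n c) : (betaMap β)^[n] c = 0 := by
  have hT := iterate_betaMap_mem_Ico (β := β) (h.mem_Ico hβ) n
  by_contra hne
  have hpos : 0 < (betaMap β)^[n] c := hT.1.lt_of_ne' hne
  have hmem := h.add_div_mem hβ (x := 1 - (betaMap β)^[n] c) ⟨by linarith [hT.2], by linarith⟩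
  have hsub := iterate_sub_iterate hmem
  rw [add_sub_cancel_left, mul_div_cancel₀ _ (by positivity)] at hsub
  linarith [(iterate_betaMap_mem_Ico (β := β) hmem.1 n).2]

theorem IsFull.iterate_add_div (hβ : 0 < β) (h : IsFull β n c) (hx : x ∈ Ico (0 : ℝ) 1) :
    (betaMap β)^[n] (c + x / β ^ n) = x := by
  have := iterate_sub_iterate (h.add_div_mem hβ hx)
  rwa [h.iterate_eq_zero hβ, sub_zero, add_sub_cancel_left,
    mul_div_cancel₀ _ (by positivity)] at this

theorem IsFull.add_div (hβ : 0 < β) (hc : IsFull β m c) (hd : IsFull β n d) :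
    IsFull β (m + n) (c + d / β ^ m) := by
  intro z hz
  obtain ⟨t, rfl⟩ : ∃ t, z = c + t / β ^ m := ⟨(z - c) * β ^ m, by field_simp; ring⟩
  have ht : t ∈ basicInterval β n d := by
    refine hd ⟨?_, ?_⟩
    · have := hz.1
      rwa [add_le_add_iff_left, div_le_div_iff_of_pos_right (by positivity)] at this
    · have := hz.2
      rw [pow_add, mul_inv, mul_comm, ← div_eq_mul_inv, add_assoc, ← _root_.add_div] at this
      rwa [add_lt_add_iff_left, div_lt_div_iff_of_pos_right (by positivity)] at this
  have hcd := hd.mem_Ico hβ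
  rw [mem_basicInterval_add, hc.iterate_add_div hβ ht.1, hc.iterate_add_div hβ hcd]
  exact ⟨mem_basicInterval_trans (hc.add_div_mem hβ ht.1)
    (mem_basicInterval_symm (hc.mem_Ico hβ) (hc.add_div_mem hβ hcd)), ht⟩

theorem isFull_zero (hβ : 1 ≤ β) (n : ℕ) : IsFull β n 0 := by
  have hβ0 : 0 < β := zero_lt_one.trans_le hβ
  induction n with
  | zero =>
    intro z hz
    exact mem_basicInterval_iff.2 ⟨by simpa using hz, by simp⟩
  | succ n ih =>
    have hone : IsFull β 1 0 := by
      intro z hz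
      rw [pow_one, zero_add] at hz
      refine mem_basicInterval_iff.2 ⟨⟨hz.1, hz.2.trans_le (inv_le_one_of_one_le₀ hβ)⟩, ?_⟩
      intro i hi
      obtain rfl : i = 0 := by omega
      change ⌊β * z⌋ = ⌊β * 0⌋
      rw [mul_zero, Int.floor_zero, Int.floor_eq_zero_iff]
      refine ⟨mul_nonneg hβ0.le hz.1, ?_⟩
      rw [mul_comm, ← lt_div_iff₀ hβ0, one_div]
      exact hz.2
    simpa using ih.add_div hβ0 hone

theorem IsFull.succ (hβ : 1 ≤ β) (h : IsFull β n c) : IsFull β (n + 1) c := by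
  simpa using h.add_div (zero_lt_one.trans_le hβ) (isFull_zero hβ 1)

theorem IsFull.eq_of_mem (hβ : 0 < β) (hc : IsFull β n c) (hd : IsFull β n d)
    (h : d ∈ basicInterval β n c) : c = d := by
  have := iterate_sub_iterate h
  rw [hc.iterate_eq_zero hβ, hd.iterate_eq_zero hβ, sub_zero, zero_eq_mul, sub_eq_zero] at this
  exact (this.resolve_left (by positivity)).symm

theorem IsFull.inv_le_abs_sub (hβ : 0 < β) (hc : IsFull β n c) (hd : IsFull β n d)
    (hne : c ≠ d) : (β ^ n)⁻¹ ≤ |c - d| := by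
  wlog hlt : c < d generalizing c d
  · rw [abs_sub_comm]
    exact this hd hc hne.symm (hne.lt_or_gt.resolve_left hlt)
  rw [abs_sub_comm, abs_of_pos (sub_pos.2 hlt), le_sub_iff_add_le']
  by_contra! h
  exact hne (hc.eq_of_mem hβ hd (hc ⟨hlt.le, h⟩))

theorem IsFull.exists_digit_ne_zero (hβ : 1 ≤ β) (h : IsFull β n c) (hc : c ≠ 0) :
    ∃ i < n, digit β c (i + 1) ≠ 0 := by
  have hβ0 : 0 < β := zero_lt_one.trans_le hβ
  by_contra! hdigit
  refine hc ((isFull_zero hβ n).eq_of_mem hβ0 h ?_).symm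
  refine mem_basicInterval_iff.2 ⟨h.mem_Ico hβ0, fun i hi => ?_⟩
  rw [hdigit i hi]
  simp [digit, iterate_betaMap_zero]

end IsFull

/-- The left endpoints of the basic intervals of order `n`. -/
def leftEndpoints (β : ℝ) (n : ℕ) : Set ℝ :=
  {c | c ∈ Ico (0 : ℝ) 1 ∧ (betaMap β)^[n] c = 0}

/-- The left endpoint of the basic interval of order `n` containing `x`. -/
def leftEndpoint (β : ℝ) (n : ℕ) (x : ℝ) : ℝ :=
  x - (betaMap β)^[n] x / β ^ n

theorem leftEndpoint_succ (hβ : β ≠ 0) (n : ℕ) (x : ℝ) :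
    leftEndpoint β (n + 1) x = (⌊β * x⌋ + leftEndpoint β n (betaMap β x)) / β := by
  simp only [leftEndpoint, Function.iterate_succ_apply]
  rw [show betaMap β x = β * x - ⌊β * x⌋ from rfl]
  field_simp
  ring

theorem leftEndpoint_mem_basicInterval (hβ : 0 < β) (n : ℕ) (hx : x ∈ Ico (0 : ℝ) 1) :
    leftEndpoint β n x ∈ basicInterval β n x := by
  induction n generalizing x with
  | zero => simp [leftEndpoint, mem_basicInterval_iff]
  | succ n ih =>
    have ih := ih (betaMap_mem_Ico β x)
    have hmap : betaMap β (leftEndpoint β (n + 1) x) = leftEndpoint β n (betaMap β x) := by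
      rw [leftEndpoint_succ hβ.ne', betaMap_add_div hβ.ne' _ ih.1]
    have hdigit : digit β (leftEndpoint β (n + 1) x) 1 = digit β x 1 := by
      change ⌊β * leftEndpoint β (n + 1) x⌋ = ⌊β * x⌋
      rw [leftEndpoint_succ hβ.ne', mul_div_cancel₀ _ hβ.ne', Int.floor_intCast_add,
        Int.floor_eq_zero_iff.2 ih.1, add_zero]
    have hmem : leftEndpoint β (n + 1) x ∈ Ico (0 : ℝ) 1 := by
      refine ⟨?_, (sub_le_self x (div_nonneg (iterate_betaMap_mem_Ico hx _).1
        (by positivity))).trans_lt hx.2⟩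
      rw [leftEndpoint_succ hβ.ne']
      have : (0 : ℝ) ≤ ⌊β * x⌋ := mod_cast Int.floor_nonneg.2 (mul_nonneg hβ.le hx.1)
      exact div_nonneg (add_nonneg this ih.1.1) hβ.le
    rw [add_comm n 1] at *
    refine mem_basicInterval_add.2 ⟨⟨hmem, fun i hi hin => ?_⟩, ?_⟩
    · rwa [le_antisymm hin hi]
    · rwa [Function.iterate_one, hmap]

theorem leftEndpoint_mem_leftEndpoints (hβ : 0 < β) (n : ℕ) (hx : x ∈ Ico (0 : ℝ) 1) :
    leftEndpoint β n x ∈ leftEndpoints β n := by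
  have hmem := leftEndpoint_mem_basicInterval hβ n hx
  have hsub := iterate_sub_iterate hmem
  rw [leftEndpoint, sub_sub_cancel_left, mul_neg, mul_div_cancel₀ _ (by positivity)] at hsub
  exact ⟨hmem.1, by rw [leftEndpoint]; linarith⟩

theorem finite_leftEndpoints (hβ : 0 < β) (n : ℕ) : (leftEndpoints β n).Finite := by
  induction n with
  | zero => exact (finite_singleton 0).subset fun c hc => hc.2
  | succ n ih =>
    refine ((finite_Icc 0 ⌊β⌋).image2 (fun (d : ℤ) (t : ℝ) => (d + t) / β) ih).subset ?_
    rintro c ⟨hc, hT⟩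
    refine ⟨⌊β * c⌋, ⟨Int.floor_nonneg.2 (mul_nonneg hβ.le hc.1), Int.floor_mono ?_⟩,
      betaMap β c, ⟨betaMap_mem_Ico β c, hT⟩, ?_⟩
    · exact mul_le_of_le_one_right hβ.le hc.2.le
    · simp only [betaMap, add_sub_cancel, mul_div_cancel_left₀ _ hβ.ne']

theorem IsFull.mem_leftEndpoints {c : ℝ} (hβ : 0 < β) (h : IsFull β n c) :
    c ∈ leftEndpoints β n :=
  ⟨h.mem_Ico hβ, h.iterate_eq_zero hβ⟩

theorem finite_setOf_isFull (hβ : 0 < β) (n : ℕ) : {c | IsFull β n c}.Finite :=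
  (finite_leftEndpoints hβ n).subset fun _ hc => hc.mem_leftEndpoints hβ

open MeasureTheory in
theorem pow_le_ncard_leftEndpoints (hβ : 0 < β) (n : ℕ) :
    β ^ n ≤ (leftEndpoints β n).ncard := by
  have hfin := finite_leftEndpoints hβ n
  have hcover : Ico (0 : ℝ) 1 ⊆ ⋃ c ∈ hfin.toFinset, Ico c (c + (β ^ n)⁻¹) := by
    intro x hx
    have hT := iterate_betaMap_mem_Ico (β := β) hx n
    refine mem_iUnion₂.2 ⟨leftEndpoint β n x,
      hfin.mem_toFinset.2 (leftEndpoint_mem_leftEndpoints hβ n hx), ?_, ?_⟩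
    · exact sub_le_self x (div_nonneg hT.1 (by positivity))
    · rw [leftEndpoint, ← sub_lt_iff_lt_add', sub_sub_cancel, inv_eq_one_div]
      gcongr
      exact hT.2
  have hvol : (1 : ENNReal) ≤ ENNReal.ofReal (hfin.toFinset.card * (β ^ n)⁻¹) :=
    calc (1 : ENNReal) = volume (Ico (0 : ℝ) 1) := by simp
      _ ≤ ∑ c ∈ hfin.toFinset, volume (Ico c (c + (β ^ n)⁻¹)) :=
        (measure_mono hcover).trans (measure_biUnion_finset_le _ _)
      _ = ENNReal.ofReal (hfin.toFinset.card * (β ^ n)⁻¹) := by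
        simp [Real.volume_Ico, ENNReal.ofReal_mul]
  rwa [ENNReal.one_le_ofReal, ← div_eq_mul_inv, one_le_div (by positivity),
    ← ncard_eq_toFinset_card _ hfin] at hvol

theorem isFull_succ_of_lt {c d : ℝ} (hβ : 0 < β) (hc : c ∈ leftEndpoints β (n + 1))
    (hd : d ∈ leftEndpoints β (n + 1)) (hdc : d ∈ basicInterval β n c) (hlt : c < d) :
    IsFull β (n + 1) c := by
  -- `T^{n+1} e = 0` says that `β T^n e` is an integer.
  have hfloor : ∀ e ∈ leftEndpoints β (n + 1),
      β * (betaMap β)^[n] e = digit β e (n + 1) := by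
    rintro e ⟨-, he⟩
    rw [Function.iterate_succ_apply'] at he
    exact sub_eq_zero.1 he
  have hstep : ∀ {e}, e ∈ basicInterval β n c →
      β * (betaMap β)^[n] e = digit β c (n + 1) + β ^ (n + 1) * (e - c) := by
    intro e he
    rw [← hfloor c hc, pow_succ', mul_assoc, ← iterate_sub_iterate he]
    ring
  have hgap : c + (β ^ (n + 1))⁻¹ ≤ d := by
    have hpos : 0 < β ^ (n + 1) * (d - c) := mul_pos (by positivity) (sub_pos.2 hlt)
    have hd' := hstep hdc
    rw [hfloor d hd] at hd'
    have : (digit β c (n + 1) : ℝ) + 1 ≤ digit β d (n + 1) := by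
      have : (digit β c (n + 1) : ℝ) < digit β d (n + 1) := by linarith
      exact_mod_cast this
    rw [← le_sub_iff_add_le', inv_le_iff_one_le_mul₀' (by positivity)]
    linarith
  intro z hz
  have hzc : z ∈ basicInterval β n c := (ordConnected_basicInterval hβ.le n c).out
    (mem_basicInterval_self n hc.1) hdc ⟨hz.1, hz.2.le.trans hgap⟩
  refine ⟨hzc.1, fun i hi hin => ?_⟩
  rcases hin.lt_or_eq with hin | rfl
  · exact hzc.2 i hi (Nat.le_of_lt_succ hin)
  · change ⌊β * (betaMap β)^[n] z⌋ = _
    rw [hstep hzc, Int.floor_intCast_add, add_eq_left, Int.floor_eq_zero_iff]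
    refine ⟨mul_nonneg (by positivity) (sub_nonneg.2 hz.1), ?_⟩
    rw [← lt_inv_mul_iff₀ (by positivity), mul_one, sub_lt_iff_lt_add']
    exact hz.2

theorem ncard_leftEndpoints_succ_le (hβ : 0 < β) (n : ℕ) :
    (leftEndpoints β (n + 1)).ncard ≤
      (leftEndpoints β n).ncard + {c | IsFull β (n + 1) c}.ncard := by
  refine (ncard_le_ncard_sdiff_add_ncard _ {c | IsFull β (n + 1) c}
    (finite_setOf_isFull hβ _)).trans (Nat.add_le_add_right ?_ _)
  refine ncard_le_ncard_of_injOn (leftEndpoint β n)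
    (fun c hc => leftEndpoint_mem_leftEndpoints hβ n hc.1.1) ?_ (finite_leftEndpoints hβ n)
  -- Only the last of the basic intervals of order `n + 1` inside one of order `n` is not full.
  rintro c ⟨hc, hc'⟩ d ⟨hd, hd'⟩ heq
  have hcd : d ∈ basicInterval β n c := by
    refine mem_basicInterval_trans (mem_basicInterval_symm hd.1
      (leftEndpoint_mem_basicInterval hβ n hd.1)) ?_
    rw [← heq]
    exact leftEndpoint_mem_basicInterval hβ n hc.1
  rcases lt_trichotomy c d with hlt | rfl | hlt
  · exact absurd (isFull_succ_of_lt hβ hc hd hcd hlt) hc'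
  · rfl
  · exact absurd (isFull_succ_of_lt hβ hd hc (mem_basicInterval_symm hc.1 hcd) hlt) hd'

theorem ncard_leftEndpoints_le (hβ : 1 ≤ β) (n : ℕ) :
    (leftEndpoints β n).ncard ≤ (n + 1) * {c | IsFull β n c}.ncard := by
  have hβ0 : 0 < β := zero_lt_one.trans_le hβ
  induction n with
  | zero =>
    rw [zero_add, one_mul]
    refine ncard_le_ncard (fun c hc => ?_) (finite_setOf_isFull hβ0 0)
    obtain rfl : c = 0 := hc.2
    exact isFull_zero hβ 0
  | succ n ih =>
    have hmono : {c | IsFull β n c}.ncard ≤ {c | IsFull β (n + 1) c}.ncard :=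
      ncard_le_ncard (fun c hc => IsFull.succ hβ hc) (finite_setOf_isFull hβ0 _)
    calc (leftEndpoints β (n + 1)).ncard
        ≤ (leftEndpoints β n).ncard + {c | IsFull β (n + 1) c}.ncard :=
          ncard_leftEndpoints_succ_le hβ0 n
      _ ≤ (n + 1) * {c | IsFull β (n + 1) c}.ncard + {c | IsFull β (n + 1) c}.ncard := by
          gcongr
          exact ih.trans (Nat.mul_le_mul_left _ hmono)
      _ = (n + 1 + 1) * {c | IsFull β (n + 1) c}.ncard := by ring

theorem pow_le_mul_ncard_isFull (hβ : 1 ≤ β) (n : ℕ) :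
    β ^ n ≤ (n + 1) * ({c | IsFull β n c}.ncard : ℝ) :=
  (pow_le_ncard_leftEndpoints (zero_lt_one.trans_le hβ) n).trans
    (mod_cast ncard_leftEndpoints_le hβ n)

/-- The left endpoints of the full basic intervals of order `m` with first digit `0`. Concatenating
their expansions always gives an admissible expansion, and the first digit `0` separates the
intervals from the right endpoint `1`. -/
def letters (β : ℝ) (m : ℕ) : Set ℝ :=
  {c | IsFull β m c ∧ c + (β ^ m)⁻¹ ≤ β⁻¹}

/-- The point of `[0, 1)` whose `β`-expansion is the concatenation of the first `m` digits of each
of the letters `w 0, w 1, …`. -/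
def point (w : ℕ → letters β m) : ℝ :=
  ∑' r, (w r : ℝ) * ((β ^ m)⁻¹) ^ r

theorem zero_mem_letters (hβ : 1 ≤ β) (hm : m ≠ 0) : 0 ∈ letters β m := by
  refine ⟨isFull_zero hβ m, ?_⟩
  rw [zero_add]
  exact inv_anti₀ (zero_lt_one.trans_le hβ) (le_self_pow₀ hβ hm)

theorem IsFull.div_mem_letters {c : ℝ} (hβ : 1 ≤ β) (h : IsFull β m c) :
    c / β ∈ letters β (m + 1) := by
  have hβ0 : 0 < β := zero_lt_one.trans_le hβ
  constructor
  · simpa [add_comm] using (isFull_zero hβ 1).add_div hβ0 h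
  · rw [pow_succ, mul_inv, div_eq_mul_inv, ← add_mul]
    exact mul_le_of_le_one_left (by positivity) (h.add_le_one hβ0)

section point

variable {v w : ℕ → letters β m}

theorem inv_pow_lt_one_of_letters (hβ : 1 < β) (c : letters β m) : (β ^ m)⁻¹ < 1 := by
  linarith [(c.2.1.mem_Ico (zero_lt_one.trans hβ)).1, c.2.2, inv_lt_one_of_one_lt₀ hβ]

theorem pos_of_letters (hβ : 1 < β) (c : letters β m) : 0 < m := by
  refine Nat.pos_of_ne_zero ?_
  rintro rfl
  simpa using inv_pow_lt_one_of_letters hβ c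

theorem summable_point (hβ : 1 < β) (w : ℕ → letters β m) :
    Summable fun r => (w r : ℝ) * ((β ^ m)⁻¹) ^ r := by
  have hβ0 : 0 < β := zero_lt_one.trans hβ
  have hmem (r : ℕ) := (w r).2.1.mem_Ico hβ0
  refine Summable.of_nonneg_of_le (fun r => mul_nonneg (hmem r).1 (by positivity))
    (fun r => mul_le_of_le_one_left (by positivity) (hmem r).2.le)
    (summable_geometric_of_lt_one (by positivity) (inv_pow_lt_one_of_letters hβ (w 0)))

theorem point_eq_add (hβ : 1 < β) (w : ℕ → letters β m) :
    point w = w 0 + point (fun r => w (r + 1)) / β ^ m := by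
  rw [point, (summable_point hβ w).tsum_eq_zero_add, point, div_eq_mul_inv, ← tsum_mul_right]
  simp only [pow_zero, mul_one, pow_succ, mul_assoc]

theorem point_mem_Icc (hβ : 1 < β) (w : ℕ → letters β m) : point w ∈ Icc 0 β⁻¹ := by
  have hβ0 : 0 < β := zero_lt_one.trans hβ
  have hρ : 0 < (β ^ m)⁻¹ := by positivity
  have hρ1 := inv_pow_lt_one_of_letters hβ (w 0)
  refine ⟨tsum_nonneg fun r => mul_nonneg ((w r).2.1.mem_Ico hβ0).1 (by positivity), ?_⟩
  have hgeom := summable_geometric_of_lt_one hρ.le hρ1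
  calc point w ≤ ∑' r : ℕ, (β⁻¹ - (β ^ m)⁻¹) * ((β ^ m)⁻¹) ^ r := by
        refine (summable_point hβ w).tsum_le_tsum (fun r => ?_) (hgeom.mul_left _)
        gcongr
        exact le_sub_iff_add_le.2 (w r).2.2
    _ = (β⁻¹ - (β ^ m)⁻¹) / (1 - (β ^ m)⁻¹) := by
        rw [tsum_mul_left, tsum_geometric_of_lt_one hρ.le hρ1, div_eq_mul_inv]
    _ ≤ β⁻¹ := by
        rw [div_le_iff₀ (by linarith)]
        linarith [mul_le_of_le_one_left hρ.le (inv_le_one_of_one_le₀ hβ.le)]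

theorem point_mem_Ico (hβ : 1 < β) (w : ℕ → letters β m) : point w ∈ Ico (0 : ℝ) 1 :=
  ⟨(point_mem_Icc hβ w).1, (point_mem_Icc hβ w).2.trans_lt (inv_lt_one_of_one_lt₀ hβ)⟩

theorem point_mem_basicInterval (hβ : 1 < β) (w : ℕ → letters β m) :
    point w ∈ basicInterval β m (w 0) := by
  rw [point_eq_add hβ]
  exact (w 0).2.1.add_div_mem (zero_lt_one.trans hβ) (point_mem_Ico hβ _)

theorem iterate_point (hβ : 1 < β) (w : ℕ → letters β m) :
    (betaMap β)^[m] (point w) = point fun r => w (r + 1) := by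
  rw [point_eq_add hβ]
  exact (w 0).2.1.iterate_add_div (zero_lt_one.trans hβ) (point_mem_Ico hβ _)

theorem iterate_mul_point (hβ : 1 < β) (w : ℕ → letters β m) (q : ℕ) :
    (betaMap β)^[q * m] (point w) = point fun r => w (q + r) := by
  induction q with
  | zero => simp
  | succ q ih =>
    rw [Nat.succ_mul, add_comm, Function.iterate_add_apply, ih, iterate_point hβ]
    simp only [add_comm, add_left_comm]

theorem digit_point (hβ : 1 < β) (w : ℕ → letters β m) (q : ℕ) {i : ℕ} (hi : i < m) :
    digit β (point w) (q * m + i + 1) = digit β (w q) (i + 1) := by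
  rw [← digit_iterate, iterate_mul_point hβ]
  exact (mem_basicInterval_iff.1 (point_mem_basicInterval hβ _)).2 i hi

theorem point_mem_basicInterval_iff (hβ : 1 < β) {q : ℕ} :
    point v ∈ basicInterval β (q * m) (point w) ↔ ∀ r < q, v r = w r := by
  have hβ0 : 0 < β := zero_lt_one.trans hβ
  induction q generalizing v w with
  | zero => simpa [mem_basicInterval_iff] using point_mem_Ico hβ v
  | succ q ih =>
    have hhead : point v ∈ basicInterval β m (point w) ↔ v 0 = w 0 := by
      have hv := point_mem_basicInterval hβ v
      have hw := point_mem_basicInterval hβ w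
      constructor
      · intro h
        exact Subtype.ext <| (v 0).2.1.eq_of_mem hβ0 (w 0).2.1 <|
          mem_basicInterval_trans (mem_basicInterval_symm ((w 0).2.1.mem_Ico hβ0) hw) <|
          mem_basicInterval_trans (mem_basicInterval_symm (point_mem_Ico hβ w) h) hv
      · intro h
        rw [h] at hv
        exact mem_basicInterval_trans hv (mem_basicInterval_symm ((w 0).2.1.mem_Ico hβ0) hw)
    rw [Nat.succ_mul, add_comm, mem_basicInterval_add, iterate_point hβ, iterate_point hβ,
      Nat.forall_lt_succ_left]
    exact and_congr hhead ih

theorem mul_le_abs_point_sub_point (hβ : 1 < β) (hne : v 0 ≠ w 0) :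
    (1 - β⁻¹) * (β ^ m)⁻¹ ≤ |point v - point w| := by
  have hβ0 : 0 < β := zero_lt_one.trans hβ
  have hρ : 0 < (β ^ m)⁻¹ := by positivity
  set p := point fun r => v (r + 1) with hp
  set p' := point fun r => w (r + 1) with hp'
  have hletters := (v 0).2.1.inv_le_abs_sub hβ0 (w 0).2.1 (Subtype.coe_ne_coe.2 hne)
  have htail : |p' - p| * (β ^ m)⁻¹ ≤ β⁻¹ * (β ^ m)⁻¹ := by
    gcongr
    simpa [Real.dist_eq] using Real.dist_le_of_mem_Icc (point_mem_Icc hβ _) (point_mem_Icc hβ _)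
  calc (1 - β⁻¹) * (β ^ m)⁻¹ ≤ |(v 0 : ℝ) - w 0| - |p' - p| * (β ^ m)⁻¹ := by linarith
    _ = |(v 0 : ℝ) - w 0| - |(p' - p) * (β ^ m)⁻¹| := by rw [abs_mul, abs_of_pos hρ]
    _ ≤ |(v 0 : ℝ) - w 0 - (p' - p) * (β ^ m)⁻¹| := abs_sub_abs_le_abs_sub _ _
    _ = |point v - point w| := by
      rw [point_eq_add hβ v, point_eq_add hβ w, ← hp, ← hp']
      congr 1
      ring

theorem mul_pow_le_abs_point_sub_point (hβ : 1 < β) {q : ℕ} (hne : v q ≠ w q) :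
    (1 - β⁻¹) * ((β ^ m)⁻¹) ^ (q + 1) ≤ |point v - point w| := by
  have hρ : 0 < (β ^ m)⁻¹ := by positivity
  have hδ : 0 ≤ 1 - β⁻¹ := sub_nonneg.2 (inv_le_one_of_one_le₀ hβ.le)
  induction q generalizing v w with
  | zero => simpa using mul_le_abs_point_sub_point hβ hne
  | succ q ih =>
    by_cases h0 : v 0 = w 0
    · have ih := ih (v := fun r => v (r + 1)) (w := fun r => w (r + 1)) hne
      rw [point_eq_add hβ v, point_eq_add hβ w, h0, add_sub_add_left_eq_sub, ← sub_div,
        div_eq_mul_inv, abs_mul, abs_of_pos hρ, pow_succ, ← mul_assoc]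
      gcongr
    · refine le_trans ?_ (mul_le_abs_point_sub_point hβ h0)
      gcongr
      exact pow_le_of_le_one hρ.le (inv_pow_lt_one_of_letters hβ (v 0)).le (q + 1).succ_ne_zero

end point

theorem exists_mul_pow_le_ncard_isFull (hβ : 1 ≤ β) {γ : ℝ} (hγ : 0 ≤ γ) (hγβ : γ < β) (C : ℝ) :
    ∃ n, C * γ ^ (n + 1) ≤ {c | IsFull β n c}.ncard := by
  have hβ0 : 0 < β := zero_lt_one.trans_le hβ
  have hlim : Tendsto (fun n : ℕ => C * γ * ((n + 1) * (γ / β) ^ n)) atTop (𝓝 0) := by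
    have hratio : γ / β < 1 := (div_lt_one hβ0).2 hγβ
    have := ((tendsto_self_mul_const_pow_of_lt_one (by positivity) hratio).add
      (tendsto_pow_atTop_nhds_zero_of_lt_one (by positivity) hratio)).const_mul (C * γ)
    simpa only [add_mul, one_mul, add_zero, mul_zero] using this
  obtain ⟨n, hn⟩ := (hlim.eventually_le_const one_pos).exists
  refine ⟨n, le_of_mul_le_mul_left (a := (n : ℝ) + 1) ?_ (by positivity)⟩
  calc (n + 1) * (C * γ ^ (n + 1)) = C * γ * ((n + 1) * (γ / β) ^ n) * β ^ n := by
        rw [div_pow]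
        field_simp
        ring
    _ ≤ 1 * β ^ n := by gcongr
    _ ≤ (n + 1) * {c | IsFull β n c}.ncard := by
        rw [one_mul]
        exact pow_le_mul_ncard_isFull hβ n

theorem exists_letters_embedding (hβ : 1 < β) {s : ℝ} (hs : 0 ≤ s) (hs1 : s < 1) :
    ∃ m N : ℕ, 2 ≤ N ∧ (β ^ m) ^ s ≤ N ∧
      ∃ e : Fin (N + 1) ↪ letters β m, ∀ i, (e i : ℝ) ≠ 0 := by
  have hβ0 : 0 < β := zero_lt_one.trans hβ
  obtain ⟨n, hn⟩ := exists_mul_pow_le_ncard_isFull hβ.le (by positivity)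
    (Real.rpow_lt_self_of_one_lt hβ hs1) 4
  have hγ : 1 ≤ (β ^ s) ^ (n + 1) := one_le_pow₀ (Real.one_le_rpow hβ.le hs)
  have hfin := finite_setOf_isFull hβ0 n
  set F := {c | IsFull β n c}.ncard
  have hF : 4 ≤ F := by
    have : (4 : ℝ) ≤ F := by linarith
    exact_mod_cast this
  have hcard : (hfin.toFinset.erase 0).card = F - 2 + 1 := by
    rw [Finset.card_erase_of_mem (by simpa using isFull_zero hβ.le n),
      ← ncard_eq_toFinset_card _ hfin]
    omega
  let g := (Finset.equivFinOfCardEq hcard).symm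
  have hg (i) : (g i : ℝ) ≠ 0 ∧ IsFull β n (g i) :=
    (Finset.mem_erase.1 (g i).2).imp_right hfin.mem_toFinset.1
  refine ⟨n + 1, F - 2, by omega, ?_, ⟨fun i => ⟨g i / β, (hg i).2.div_mem_letters hβ.le⟩, ?_⟩,
    fun i => div_ne_zero (hg i).1 hβ0.ne'⟩
  · rw [← Real.rpow_natCast_mul hβ0.le, mul_comm, Real.rpow_mul_natCast hβ0.le,
      Nat.cast_sub (by omega), Nat.cast_ofNat]
    linarith
  · intro i j hij
    simpa [div_left_inj' hβ0.ne', Subtype.ext_iff] using hij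

/-- The prefixes of the word `w`, of lengths `3, 4, 5, …`, occur in the word `v` at the places
`Q 0, Q 1, …` and are not continued there, and nowhere else does `v` contain the letter `z` that
`w` starts with. Since `w` starts with exactly two letters `z`, this makes the places `Q n`
recognizable. -/
structure IsInsertion {α : Type*} (Q : ℕ → ℕ) (z : α) (v w : ℕ → α) : Prop where
  eq_of_lt : ∀ n, ∀ r < n + 3, v (Q n + r) = w r
  ne : ∀ n, v (Q n + (n + 3)) ≠ w (n + 3)
  of_eq : ∀ q, v q = z → ∃ n, q = Q n ∨ q = Q n + 1
  zero_eq : w 0 = z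
  one_eq : w 1 = z
  two_ne : w 2 ≠ z

section IsInsertion

variable {Q : ℕ → ℕ} {o : letters β m} {v w : ℕ → letters β m}

theorem letters_eq_of_digit_eq_zero (hβ : 1 < β) (ho : (o : ℝ) = 0) {c : letters β m}
    (hc : ∀ i < m, digit β c (i + 1) = 0) : c = o := by
  by_contra hne
  obtain ⟨i, him, hi⟩ := c.2.1.exists_digit_ne_zero hβ.le (ho ▸ Subtype.coe_ne_coe.2 hne)
  exact hi (hc i him)

theorem digit_zero_letter (ho : (o : ℝ) = 0) (i : ℕ) : digit β o i = 0 := by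
  simp [ho, digit, iterate_betaMap_zero]

theorem IsInsertion.iterate_mem (hβ : 1 < β) (h : IsInsertion Q o v w) (n : ℕ) :
    (betaMap β)^[Q n * m] (point v) ∈ basicInterval β ((n + 3) * m) (point w) := by
  rw [iterate_mul_point hβ, point_mem_basicInterval_iff hβ]
  exact h.eq_of_lt n

theorem IsInsertion.exists_leading_zeros (hβ : 1 < β) (ho : (o : ℝ) = 0)
    (h : IsInsertion Q o v w) : ∃ l, 2 * m ≤ l ∧ l < 3 * m ∧
      (∀ j < l, digit β (point w) (j + 1) = 0) ∧ digit β (point w) (l + 1) ≠ 0 := by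
  classical
  obtain ⟨i, him, hi⟩ : ∃ i < m, digit β (w 2) (i + 1) ≠ 0 := by
    by_contra! hcon
    exact h.two_ne (letters_eq_of_digit_eq_zero hβ ho hcon)
  have hex : ∃ l, digit β (point w) (l + 1) ≠ 0 := ⟨2 * m + i, by rwa [digit_point hβ w 2 him]⟩
  refine ⟨Nat.find hex, ?_, ?_, fun j hj => not_not.1 (Nat.find_min hex hj), Nat.find_spec hex⟩
  · refine (Nat.le_find_iff hex _).2 fun j hj => not_not.2 ?_
    rcases lt_or_ge j m with hjm | hmj
    · have := digit_point hβ w 0 hjm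
      rwa [zero_mul, zero_add, h.zero_eq, digit_zero_letter ho] at this
    · obtain ⟨i, rfl⟩ := Nat.exists_eq_add_of_le hmj
      have := digit_point hβ w 1 (i := i) (by omega)
      rwa [one_mul, h.one_eq, digit_zero_letter ho] at this
  · exact (Nat.find_min' hex (by rwa [digit_point hβ w 2 him])).trans_lt (by omega)

theorem IsInsertion.exists_near (hβ : 1 < β) (ho : (o : ℝ) = 0) (h : IsInsertion Q o v w)
    (hk : (betaMap β)^[k] (point v) ∈ basicInterval β (3 * m) (point w)) :
    ∃ n, k ≤ Q n * m + m ∧ Q n * m < k + m := by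
  have hm : 0 < m := pos_of_letters hβ o
  obtain ⟨l, hl, hl', hzero, -⟩ := h.exists_leading_zeros hβ ho
  have hkq : k ≤ k ⌈/⌉ m * m := by
    simpa only [smul_eq_mul, mul_comm] using le_smul_ceilDiv (b := k) hm
  have hqk : k ⌈/⌉ m * m < k + m := by
    have := Nat.div_mul_le_self (k + m - 1) m
    rw [Nat.ceilDiv_eq_add_pred_div]
    omega
  have hblock : v (k ⌈/⌉ m) = o := by
    refine letters_eq_of_digit_eq_zero hβ ho fun i hi => ?_
    have := (mem_basicInterval_iff.1 hk).2 (k ⌈/⌉ m * m + i - k) (by omega)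
    rwa [digit_iterate, hzero _ (by omega), Nat.add_sub_cancel' (by omega),
      digit_point hβ v _ hi] at this
  obtain ⟨n, hn | hn⟩ := h.of_eq _ hblock
  · rw [hn] at hkq hqk
    exact ⟨n, by omega, hqk⟩
  · rw [hn, Nat.succ_mul] at hkq hqk
    exact ⟨n, hkq, by omega⟩

theorem le_of_leading_zeros {D E : ℕ → ℤ} {l p : ℕ} (hzero : ∀ j < l, E j = 0) (hne : E l ≠ 0)
    (hk : ∀ j ≤ l, D (k + j) = E j) (hp : ∀ j ≤ l, D (p + j) = E j) (hpk : p ≤ k + l) :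
    p ≤ k := by
  by_contra! hlt
  refine hne ?_
  rw [← hk l le_rfl, ← hzero (l - (p - k)) (by omega), ← hp _ (by omega)]
  congr 1
  omega

theorem IsInsertion.exists_eq_mul (hβ : 1 < β) (ho : (o : ℝ) = 0) (h : IsInsertion Q o v w)
    (hk : (betaMap β)^[k] (point v) ∈ basicInterval β (3 * m) (point w)) :
    ∃ n, k = Q n * m := by
  obtain ⟨n, hkQ, hQk⟩ := h.exists_near hβ ho hk
  obtain ⟨l, hl, hl', hzero, hne⟩ := h.exists_leading_zeros hβ ho
  have hdigit {p : ℕ} (hp : (betaMap β)^[p] (point v) ∈ basicInterval β (3 * m) (point w)) :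
      ∀ j ≤ l, digit β (point v) (p + j + 1) = digit β (point w) (j + 1) := fun j hj => by
    simpa only [digit_iterate] using (mem_basicInterval_iff.1 hp).2 j (by omega)
  have hQ := hdigit (basicInterval_antitone β (point w)
    (Nat.mul_le_mul_right m (Nat.le_add_left 3 n)) (h.iterate_mem hβ n))
  have hk := hdigit hk
  exact ⟨n, le_antisymm
    (le_of_leading_zeros (D := fun j => digit β (point v) (j + 1))
      (E := fun j => digit β (point w) (j + 1)) hzero hne hQ hk (by omega))
    (le_of_leading_zeros (D := fun j => digit β (point v) (j + 1))
      (E := fun j => digit β (point w) (j + 1)) hzero hne hk hQ (by omega))⟩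

theorem IsInsertion.waitingTime_eq (hβ : 1 < β) (ho : (o : ℝ) = 0) (h : IsInsertion Q o v w)
    (hQ : StrictMono Q) (hQ0 : 0 < Q 0) (n : ℕ) :
    waitingTime β ((n + 3) * m) (point v) (point w) = (Q n * m : ℕ) := by
  have hpos : 0 < Q n := hQ0.trans_le (hQ.monotone n.zero_le)
  refine le_antisymm (iInf₂_le (Q n * m) ⟨Nat.mul_pos hpos (pos_of_letters hβ o),
    h.iterate_mem hβ n⟩) (le_iInf₂ fun k ⟨_, hk⟩ => Nat.cast_le.2 ?_)
  obtain ⟨j, rfl⟩ := h.exists_eq_mul hβ ho (basicInterval_antitone β _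
    (Nat.mul_le_mul_right m (Nat.le_add_left 3 n)) hk)
  refine Nat.mul_le_mul_right m (hQ.monotone ?_)
  by_contra! hjn
  rw [iterate_mul_point hβ, point_mem_basicInterval_iff hβ] at hk
  exact h.ne j (hk (j + 3) (by omega))

theorem waitingTime_mono (β x y : ℝ) : Monotone fun n => waitingTime β n x y :=
  fun _ _ hmn => iInf₂_mono' fun k hk => ⟨k, ⟨hk.1, basicInterval_antitone β y hmn hk.2⟩, le_rfl⟩

end IsInsertion

section Layout

/-- The place `Q n + r` of the `r`-th letter of the `n`-th insertion, which has length `n + 4`. -/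
def insertionPlace (Q : ℕ → ℕ) (s : Σ n, Fin (n + 4)) : ℕ :=
  Q s.1 + s.2

/-- The places outside the insertions. -/
def IsFree (Q : ℕ → ℕ) (q : ℕ) : Prop :=
  q ∉ range (insertionPlace Q)

open Classical in
/-- The word obtained from `ξ` by inserting, for each `n`, the first `n + 3` letters of `w`
followed by `t` at the places `Q n, …, Q n + n + 3`. -/
def layout {α : Type*} (Q : ℕ → ℕ) (t : α) (w ξ : ℕ → α) : ℕ → α :=
  Function.extend (insertionPlace Q) (fun s => if (s.2 : ℕ) = s.1 + 3 then t else w s.2)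
    fun q => ξ (Nat.count (IsFree Q) q)

/-- The word `η` preceded by two letters `z`. -/
def marked {α : Type*} (z : α) (η : ℕ → α) : ℕ → α
  | 0 => z
  | 1 => z
  | q + 2 => η q

variable {α : Type*} {Q : ℕ → ℕ} {t z : α} {w ξ η : ℕ → α}

theorem insertionPlace_injective (hQ : ∀ n, Q n + (n + 4) ≤ Q (n + 1)) :
    Function.Injective (insertionPlace Q) := by
  have hmono : Monotone Q := monotone_nat_of_le_succ fun n =>
    (Nat.le_add_right _ _).trans (hQ n)
  have hlt {n n' : ℕ} (r : Fin (n + 4)) (r' : Fin (n' + 4)) (h : n < n') : Q n + r < Q n' + r' := by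
    have := hQ n
    have := hmono (Nat.succ_le_of_lt h)
    rw [Nat.succ_eq_add_one] at this
    omega
  rintro ⟨n, r⟩ ⟨n', r'⟩ h
  obtain rfl : n = n' := by
    rcases lt_trichotomy n n' with h' | h' | h'
    · exact absurd h (hlt r r' h').ne
    · exact h'
    · exact absurd h (hlt r' r h').ne'
  obtain rfl : r = r' := Fin.ext (Nat.add_left_cancel h)
  rfl

theorem layout_insertionPlace (hQ : ∀ n, Q n + (n + 4) ≤ Q (n + 1)) (s : Σ n, Fin (n + 4)) :
    layout Q t w ξ (Q s.1 + s.2) = if (s.2 : ℕ) = s.1 + 3 then t else w s.2 :=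
  (insertionPlace_injective hQ).extend_apply _ _ s

theorem layout_add (hQ : ∀ n, Q n + (n + 4) ≤ Q (n + 1)) {n r : ℕ} (hr : r < n + 3) :
    layout Q t w ξ (Q n + r) = w r :=
  (layout_insertionPlace hQ ⟨n, r, by omega⟩).trans (if_neg hr.ne)

theorem layout_add_last (hQ : ∀ n, Q n + (n + 4) ≤ Q (n + 1)) (n : ℕ) :
    layout Q t w ξ (Q n + (n + 3)) = t :=
  (layout_insertionPlace hQ ⟨n, n + 3, by omega⟩).trans (if_pos rfl)

open Classical in
theorem layout_of_isFree {q : ℕ} (hq : IsFree Q q) :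
    layout Q t w ξ q = ξ (Nat.count (IsFree Q) q) :=
  Function.extend_apply' _ _ _ hq

theorem isInsertion_layout (hQ : ∀ n, Q n + (n + 4) ≤ Q (n + 1)) (hξ : ∀ q, ξ q ≠ z)
    (hη : ∀ q, η q ≠ z) (ht : t ≠ z) (hηt : ∀ q, η q ≠ t) :
    IsInsertion Q z (layout Q t (marked z η) ξ) (marked z η) where
  eq_of_lt n r hr := layout_add hQ hr
  ne n := by
    rw [layout_add_last hQ]
    exact (hηt (n + 1)).symm
  of_eq q hq := by
    classical
    by_cases hfree : IsFree Q q
    · rw [layout_of_isFree hfree] at hq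
      exact absurd hq (hξ _)
    · obtain ⟨⟨n, r⟩, rfl⟩ := not_not.1 hfree
      rw [insertionPlace, layout_insertionPlace hQ] at hq
      split_ifs at hq
      · exact absurd hq ht
      refine ⟨n, ?_⟩
      match r, hq with
      | ⟨0, _⟩, _ => exact Or.inl rfl
      | ⟨1, _⟩, _ => exact Or.inr rfl
      | ⟨r + 2, _⟩, hq => exact absurd hq (hη r)
  zero_eq := rfl
  one_eq := rfl
  two_ne := hη 0

open Classical in
theorem mul_le_mul_count_isFree_add {R : ℕ} (hR : ∀ n, R * (n + 4) ^ 2 ≤ Q n) (q : ℕ) :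
    R * q ≤ R * Nat.count (IsFree Q) q + q := by
  rcases R.eq_zero_or_pos with rfl | hRpos
  · simp
  set M := Nat.sqrt (q / R) with hM
  have hsub : {i ∈ Finset.range q | ¬IsFree Q i} ⊆
      (Finset.range M ×ˢ Finset.range M).image fun p => Q p.1 + p.2 := by
    intro i hi
    obtain ⟨hiq, hfree⟩ := Finset.mem_filter.1 hi
    obtain ⟨⟨n, r⟩, rfl⟩ := not_not.1 hfree
    have hnM : n + 4 ≤ M := by
      rw [hM, Nat.le_sqrt', Nat.le_div_iff_mul_le hRpos, mul_comm]
      exact (hR n).trans ((Nat.le_add_right _ _).trans (Finset.mem_range.1 hiq).le)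
    exact Finset.mem_image.2 ⟨(n, r), Finset.mem_product.2
      ⟨Finset.mem_range.2 (by omega), Finset.mem_range.2 (r.2.trans_le hnM)⟩, rfl⟩
  have hcard : {i ∈ Finset.range q | ¬IsFree Q i}.card ≤ q / R := by
    refine (Finset.card_le_card hsub).trans (Finset.card_image_le.trans ?_)
    rw [Finset.card_product, Finset.card_range]
    exact Nat.sqrt_le _
  have hsplit := Finset.card_filter_add_card_filter_not (s := Finset.range q) (IsFree Q)
  rw [Finset.card_range, ← Nat.count_eq_card_filter_range] at hsplit
  calc R * q = R * Nat.count (IsFree Q) q + R * {i ∈ Finset.range q | ¬IsFree Q i}.card := by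
        rw [← mul_add, hsplit]
    _ ≤ R * Nat.count (IsFree Q) q + q := by
        gcongr
        exact (Nat.mul_le_mul_left R hcard).trans (Nat.mul_div_le q R)

open Classical in
theorem exists_isFree_count_eq {R : ℕ} (hR2 : 2 ≤ R) (hR : ∀ n, R * (n + 4) ^ 2 ≤ Q n) (n : ℕ) :
    ∃ q, IsFree Q q ∧ Nat.count (IsFree Q) q = n := by
  have hex : ∃ q, n < Nat.count (IsFree Q) q := by
    by_contra! hle
    have h1 := mul_le_mul_count_isFree_add hR (R * n + 1)
    have h2 := Nat.mul_le_mul_left R (hle (R * n + 1))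
    have h3 := Nat.mul_le_mul_right (R * n + 1) hR2
    omega
  have hne : Nat.find hex ≠ 0 := by
    intro h
    simpa [h] using Nat.find_spec hex
  obtain ⟨q, hq⟩ := Nat.exists_eq_succ_of_ne_zero hne
  have hlt := Nat.find_spec hex
  have hle := not_lt.1 (Nat.find_min hex (m := q) (by omega))
  rw [hq, Nat.count_succ] at hlt
  split_ifs at hlt with hfree
  · exact ⟨q, hfree, by omega⟩
  · omega

theorem exists_layout_ne {R : ℕ} (hR2 : 2 ≤ R) (hR : ∀ n, R * (n + 4) ^ 2 ≤ Q n) {ξ' : ℕ → α}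
    {n : ℕ} (hne : ξ n ≠ ξ' n) (w' : ℕ → α) :
    ∃ q, R * q ≤ R * n + q ∧ layout Q t w ξ q ≠ layout Q t w' ξ' q := by
  classical
  obtain ⟨q, hfree, rfl⟩ := exists_isFree_count_eq hR2 hR n
  refine ⟨q, mul_le_mul_count_isFree_add hR q, ?_⟩
  rwa [layout_of_isFree hfree, layout_of_isFree hfree]

end Layout

section Growth

open ExpGrowth
open scoped ENNReal

variable {a b : EReal}

theorem expGrowthSup_natCast_pow (k : ℕ) : expGrowthSup (fun n => (n : ℝ≥0∞) ^ k) = 0 := by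
  refine le_antisymm (EReal.le_of_forall_lt_iff_le.1 fun c hc => ?_) ?_
  · have hlittle := (isLittleO_pow_exp_pos_mul_atTop k (EReal.coe_pos.1 hc)).comp_tendsto
      (tendsto_natCast_atTop_atTop (R := ℝ))
    refine Eventually.expGrowthSup_le ((hlittle.bound one_pos).mono fun n hn => ?_)
    simp only [Function.comp_apply, norm_pow, Real.norm_eq_abs, Real.abs_exp, Nat.abs_cast,
      one_mul] at hn
    rw [← EReal.coe_natCast, ← EReal.coe_mul, EReal.exp_coe, ← ENNReal.ofReal_natCast,
      ← ENNReal.ofReal_pow n.cast_nonneg]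
    exact ENNReal.ofReal_le_ofReal hn
  · refine Monotone.expGrowthSup_nonneg (fun m n hmn => ?_) fun h => ?_
    · exact pow_le_pow_left' (Nat.cast_le.2 hmn) k
    · simpa using congrFun h 1

theorem expGrowthInf_natCast_pow_mul_le (k : ℕ) (u : ℕ → ℝ≥0∞) :
    expGrowthInf (fun n => (n : ℝ≥0∞) ^ k * u n) ≤ expGrowthInf u := by
  have h := expGrowthInf_mul_le (u := fun n => (n : ℝ≥0∞) ^ k) (v := u)
  rw [expGrowthSup_natCast_pow, zero_add] at h
  exact h (Or.inl EReal.zero_ne_bot) (Or.inl EReal.zero_ne_top)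

theorem expGrowthSup_natCast_pow_mul_le (k : ℕ) (u : ℕ → ℝ≥0∞) :
    expGrowthSup (fun n => (n : ℝ≥0∞) ^ k * u n) ≤ expGrowthSup u := by
  have h := expGrowthSup_mul_le (u := fun n => (n : ℝ≥0∞) ^ k) (v := u)
  rw [expGrowthSup_natCast_pow, zero_add] at h
  exact h (Or.inl EReal.zero_ne_bot) (Or.inl EReal.zero_ne_top)

/-- The largest number of the form `2 ^ 4 ^ k` that is at most `n`, for `n ≥ 2`. -/
def lacunary (n : ℕ) : ℕ :=
  2 ^ 4 ^ Nat.log 4 (Nat.log 2 n)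

theorem lacunary_mono : Monotone lacunary := fun _ _ h =>
  Nat.pow_le_pow_right two_pos (Nat.pow_le_pow_right four_pos (Nat.log_mono_right
    (Nat.log_mono_right h)))

theorem lacunary_le (hn : 2 ≤ n) : lacunary n ≤ n :=
  (Nat.pow_le_pow_right two_pos (Nat.pow_log_le_self 4 (Nat.log_pos one_lt_two hn).ne')).trans
    (Nat.pow_log_le_self 2 (by omega))

theorem lacunary_two_pow_four_pow (k : ℕ) : lacunary (2 ^ 4 ^ k) = 2 ^ 4 ^ k := by
  rw [lacunary, Nat.log_pow one_lt_two, Nat.log_pow (by norm_num)]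

theorem lacunary_two_pow_four_pow_cube (k : ℕ) : lacunary ((2 ^ 4 ^ k) ^ 3) = 2 ^ 4 ^ k := by
  have hlog : Nat.log 4 (4 ^ k * 3) = k := by
    refine Nat.log_eq_of_pow_le_of_lt_pow (by omega) ?_
    rw [pow_succ]
    have := Nat.pow_pos (n := k) (by norm_num : 0 < 4)
    omega
  rw [lacunary, ← pow_mul, Nat.log_pow one_lt_two, hlog]

theorem tendsto_two_pow_four_pow : Tendsto (fun k => 2 ^ 4 ^ k : ℕ → ℕ) atTop atTop :=
  (tendsto_pow_atTop_atTop_of_one_lt one_lt_two).comp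
    (tendsto_pow_atTop_atTop_of_one_lt (by norm_num))

/-- A nondecreasing function whose quotient by `n` oscillates between `a` and `b`: it is about
`b * n` at `n = 2 ^ 4 ^ k` and then constant until it is about `a * n`. Slopes are truncated at
`n`, so that the values are finite. -/
def profile (a b : EReal) (n : ℕ) : EReal :=
  max (min a n * n) (min b (lacunary n) * lacunary n)

theorem min_mul_mono (ha : 0 ≤ a) : Monotone fun n : ℕ => min a n * n := by
  intro m n h
  have hmn : (m : EReal) ≤ n := Nat.cast_le.2 h
  exact mul_le_mul (min_le_min_left a hmn) hmn m.cast_nonneg'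
    (le_min ha n.cast_nonneg')

theorem min_mul_le (a : EReal) (n : ℕ) : min a n * n ≤ (n * n : ℕ) := by
  rw [EReal.natCast_mul]
  exact mul_le_mul_of_nonneg_right (min_le_right _ _) n.cast_nonneg'

theorem profile_mono (ha : 0 ≤ a) (hb : 0 ≤ b) : Monotone (profile a b) := fun _ _ h =>
  max_le_max (min_mul_mono ha h) (min_mul_mono hb (lacunary_mono h))

theorem profile_nonneg (ha : 0 ≤ a) (n : ℕ) : 0 ≤ profile a b n :=
  le_max_of_le_left (EReal.mul_nonneg (le_min ha n.cast_nonneg') n.cast_nonneg')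

theorem profile_ne_top (a b : EReal) (n : ℕ) : profile a b n ≠ ⊤ :=
  (max_lt ((min_mul_le a n).trans_lt (EReal.natCast_ne_top _).lt_top)
    ((min_mul_le b _).trans_lt (EReal.natCast_ne_top _).lt_top)).ne

theorem profile_le (ha : 0 ≤ a) (hab : a ≤ b) (hn : 2 ≤ n) : profile a b n ≤ b * n := by
  refine max_le ?_ ?_
  · exact mul_le_mul_of_nonneg_right ((min_le_left _ _).trans hab) n.cast_nonneg'
  · exact mul_le_mul (min_le_left _ _) (Nat.cast_le.2 (lacunary_le hn))
      (Nat.cast_nonneg' _) (ha.trans hab)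

theorem le_profile {c : EReal} (hca : c ≤ a) (hcn : c ≤ n) : c * n ≤ profile a b n :=
  le_max_of_le_left (mul_le_mul_of_nonneg_right (le_min hca hcn) n.cast_nonneg')

theorem le_profile_of_lacunary_eq {c : EReal} (hcb : c ≤ b) (hcn : c ≤ n) (hn : lacunary n = n) :
    c * n ≤ profile a b n := by
  rw [profile, hn]
  exact le_max_of_le_right (mul_le_mul_of_nonneg_right (le_min hcb hcn) n.cast_nonneg')

theorem profile_le_of_lacunary_cube_eq {c : EReal} (hac : a ≤ c) (hc : 1 ≤ c * k)
    (hk : lacunary (k ^ 3) = k) : profile a b (k ^ 3 : ℕ) ≤ c * (k ^ 3 : ℕ) := by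
  refine max_le (mul_le_mul_of_nonneg_right ((min_le_left _ _).trans hac) (Nat.cast_nonneg' _)) ?_
  rw [hk]
  calc min b k * k ≤ (k * k : ℕ) := min_mul_le b k
    _ = 1 * ((k * k : ℕ) : EReal) := (one_mul _).symm
    _ ≤ c * k * (k * k : ℕ) := mul_le_mul_of_nonneg_right hc (Nat.cast_nonneg' _)
    _ = c * (k ^ 3 : ℕ) := by
      rw [mul_assoc, ← EReal.natCast_mul, pow_succ' k 2, sq]

theorem eventually_le_two_pow_four_pow (c : ℝ) :
    ∀ᶠ k : ℕ in atTop, c ≤ (2 ^ 4 ^ k : ℕ) :=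
  (tendsto_natCast_atTop_atTop.comp tendsto_two_pow_four_pow).eventually_ge_atTop c

theorem expGrowthInf_exp_profile (ha : 0 ≤ a) :
    expGrowthInf (fun n => EReal.exp (profile a b n)) = a := by
  refine le_antisymm (EReal.le_of_forall_lt_iff_le.1 fun c hc => ?_)
    (EReal.ge_of_forall_gt_iff_ge.1 fun c hc => ?_)
  · have hc0 : 0 < c := EReal.coe_pos.1 (ha.trans_lt hc)
    refine Frequently.expGrowthInf_le (((tendsto_pow_atTop three_ne_zero).comp
      tendsto_two_pow_four_pow).frequently (Eventually.frequently ?_))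
    filter_upwards [eventually_le_two_pow_four_pow c⁻¹] with k hk
    refine EReal.exp_monotone (profile_le_of_lacunary_cube_eq hc.le ?_
      (lacunary_two_pow_four_pow_cube k))
    rw [inv_le_iff_one_le_mul₀' hc0] at hk
    exact EReal.coe_le_coe_iff.2 hk
  · refine Eventually.le_expGrowthInf ?_
    filter_upwards [tendsto_natCast_atTop_atTop.eventually_ge_atTop c] with n hn
    exact EReal.exp_monotone (le_profile hc.le (EReal.coe_le_coe_iff.2 hn))

theorem expGrowthSup_exp_profile (ha : 0 ≤ a) (hab : a ≤ b) :
    expGrowthSup (fun n => EReal.exp (profile a b n)) = b := by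
  refine le_antisymm ?_ (EReal.ge_of_forall_gt_iff_ge.1 fun c hc => ?_)
  · refine Eventually.expGrowthSup_le ?_
    filter_upwards [eventually_ge_atTop 2] with n hn
    exact EReal.exp_monotone (profile_le ha hab hn)
  · refine Frequently.le_expGrowthSup (tendsto_two_pow_four_pow.frequently
      (Eventually.frequently ?_))
    filter_upwards [eventually_le_two_pow_four_pow c] with k hk
    exact EReal.exp_monotone (le_profile_of_lacunary_eq hc.le (EReal.coe_le_coe_iff.2 hk)
      (lacunary_two_pow_four_pow k))

/-- A sequence of natural numbers with the exponential growth of `exp (profile a b n)`. The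
factor `R * (n + 4) ^ 2` leaves room for insertions of total density at most `1 / R`. -/
def growthSeq (R : ℕ) (a b : EReal) (n : ℕ) : ℕ :=
  R * (n + 4) ^ 2 * ⌈(EReal.exp (profile a b n)).toReal⌉₊

theorem one_le_toReal_exp_profile (ha : 0 ≤ a) (n : ℕ) :
    1 ≤ (EReal.exp (profile a b n)).toReal := by
  rw [← ENNReal.toReal_one]
  exact ENNReal.toReal_mono (by simpa using profile_ne_top a b n)
    (EReal.one_le_exp_iff.2 (profile_nonneg ha n))

theorem mul_sq_le_growthSeq (R : ℕ) (ha : 0 ≤ a) (n : ℕ) :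
    R * (n + 4) ^ 2 ≤ growthSeq R a b n :=
  Nat.le_mul_of_pos_right _ (Nat.ceil_pos.2 (one_pos.trans_le (one_le_toReal_exp_profile ha n)))

theorem growthSeq_add_le {R : ℕ} (hR : R ≠ 0) (ha : 0 ≤ a) (hb : 0 ≤ b) (n : ℕ) :
    growthSeq R a b n + (n + 4) ≤ growthSeq R a b (n + 1) := by
  have hceil : ⌈(EReal.exp (profile a b n)).toReal⌉₊ ≤
      ⌈(EReal.exp (profile a b (n + 1))).toReal⌉₊ :=
    Nat.ceil_le_ceil (ENNReal.toReal_mono (by simpa using profile_ne_top a b (n + 1))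
      (EReal.exp_monotone (profile_mono ha hb n.le_succ)))
  have hpos : 1 ≤ ⌈(EReal.exp (profile a b n)).toReal⌉₊ :=
    Nat.ceil_pos.2 (one_pos.trans_le (one_le_toReal_exp_profile ha n))
  rw [growthSeq, growthSeq]
  set p := ⌈(EReal.exp (profile a b n)).toReal⌉₊
  calc R * (n + 4) ^ 2 * p + (n + 4) ≤ R * (n + 4) ^ 2 * p + R * (n + 4) * p := by
        gcongr
        rw [mul_right_comm]
        exact Nat.le_mul_of_pos_left _ (Nat.mul_pos (Nat.pos_of_ne_zero hR) hpos)
    _ = R * ((n + 4) * (n + 5)) * p := by ring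
    _ ≤ R * (n + 1 + 4) ^ 2 * p := by
        gcongr
        nlinarith
    _ ≤ _ := by gcongr

theorem exp_profile_le_growthSeq {R : ℕ} (hR : R ≠ 0) (a b : EReal) (n : ℕ) :
    EReal.exp (profile a b n) ≤ (growthSeq R a b n : ℕ) := by
  have hfin : EReal.exp (profile a b n) ≠ ∞ := by simpa using profile_ne_top a b n
  rw [← ENNReal.ofReal_toReal hfin, ← ENNReal.ofReal_natCast]
  refine ENNReal.ofReal_le_ofReal ((Nat.le_ceil _).trans (Nat.cast_le.2 ?_))
  exact Nat.le_mul_of_pos_left _ (by positivity)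

theorem growthSeq_le {R : ℕ} (ha : 0 ≤ a) (hn : 1 ≤ n) :
    (growthSeq R a b n : ℝ≥0∞) ≤
      (50 * R : ℕ) * ((n : ℝ≥0∞) ^ 2 * EReal.exp (profile a b n)) := by
  have hone := one_le_toReal_exp_profile (b := b) ha n
  have hceil : (⌈(EReal.exp (profile a b n)).toReal⌉₊ : ℝ≥0∞) ≤ 2 * EReal.exp (profile a b n) := by
    rw [← ENNReal.ofReal_toReal (a := 2 * _)
      (ENNReal.mul_ne_top ENNReal.ofNat_ne_top (by simpa using profile_ne_top a b n)),
      ENNReal.toReal_mul, ← ENNReal.ofReal_natCast]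
    exact ENNReal.ofReal_le_ofReal (Nat.ceil_le_two_mul (by linarith))
  have hsq : (n + 4) ^ 2 ≤ 25 * n ^ 2 := by nlinarith
  calc (growthSeq R a b n : ℝ≥0∞)
      ≤ R * (25 * n ^ 2 : ℕ) * (2 * EReal.exp (profile a b n)) := by
        rw [growthSeq, Nat.cast_mul, Nat.cast_mul]
        gcongr
    _ = _ := by
        push_cast
        ring

theorem expGrowthInf_growthSeq {R : ℕ} (hR : R ≠ 0) (ha : 0 ≤ a) :
    expGrowthInf (fun n => (growthSeq R a b n : ℝ≥0∞)) = a := by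
  conv_rhs => rw [← expGrowthInf_exp_profile (b := b) ha]
  refine le_antisymm ?_ (expGrowthInf_monotone (exp_profile_le_growthSeq hR a b))
  refine le_trans ?_ (expGrowthInf_natCast_pow_mul_le 2 _)
  exact expGrowthInf_le_of_eventually_le (ENNReal.natCast_ne_top (50 * R))
    ((eventually_ge_atTop 1).mono fun n hn => growthSeq_le ha hn)

theorem expGrowthSup_growthSeq {R : ℕ} (hR : R ≠ 0) (ha : 0 ≤ a) (hab : a ≤ b) :
    expGrowthSup (fun n => (growthSeq R a b n : ℝ≥0∞)) = b := by
  conv_rhs => rw [← expGrowthSup_exp_profile ha hab]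
  refine le_antisymm ?_ (expGrowthSup_monotone (exp_profile_le_growthSeq hR a b))
  refine le_trans ?_ (expGrowthSup_natCast_pow_mul_le 2 _)
  exact expGrowthSup_le_of_eventually_le (ENNReal.natCast_ne_top (50 * R))
    ((eventually_ge_atTop 1).mono fun n hn => growthSeq_le ha hn)

theorem expGrowthInf_natCast_mul {u : ℕ → ℕ} (hm : m ≠ 0) :
    expGrowthInf (fun n => ((u n * m : ℕ) : ℝ≥0∞)) = expGrowthInf fun n => (u n : ℝ≥0∞) := by
  refine le_antisymm (expGrowthInf_le_of_eventually_le (ENNReal.natCast_ne_top m)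
    (.of_forall fun n => ?_)) (expGrowthInf_monotone fun n => ?_)
  · rw [Nat.cast_mul, mul_comm]
  · exact Nat.cast_le.2 (Nat.le_mul_of_pos_right _ (Nat.pos_of_ne_zero hm))

theorem expGrowthSup_natCast_mul {u : ℕ → ℕ} (hm : m ≠ 0) :
    expGrowthSup (fun n => ((u n * m : ℕ) : ℝ≥0∞)) = expGrowthSup fun n => (u n : ℝ≥0∞) := by
  refine le_antisymm (expGrowthSup_le_of_eventually_le (ENNReal.natCast_ne_top m)
    (.of_forall fun n => ?_)) (expGrowthSup_monotone fun n => ?_)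
  · rw [Nat.cast_mul, mul_comm]
  · exact Nat.cast_le.2 (Nat.le_mul_of_pos_right _ (Nat.pos_of_ne_zero hm))

theorem tendsto_natCast_add_mul_div (k m : ℕ) :
    Tendsto (fun n : ℕ => (((n + k) * m : ℕ) : EReal) / n) atTop (𝓝 m) := by
  have hreal : Tendsto (fun n : ℕ => (m : ℝ) + ((k * m : ℕ) : ℝ) / n) atTop (𝓝 (m + 0)) :=
    tendsto_const_nhds.add (tendsto_const_div_atTop_nhds_zero_nat _)
  rw [add_zero] at hreal
  refine ((continuous_coe_real_ereal.tendsto _).comp hreal).congr' ?_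
  filter_upwards [eventually_ne_atTop 0] with n hn
  have hn' : (n : ℝ) ≠ 0 := Nat.cast_ne_zero.2 hn
  rw [← EReal.coe_natCast (n := n), ← EReal.coe_natCast (n := (n + k) * m), ← EReal.coe_div,
    Function.comp_apply]
  congr 1
  push_cast
  field_simp

theorem natCast_mul_lowerIndicator (hm : m ≠ 0) {Q : ℕ → ℕ}
    (hW : ∀ n, waitingTime β ((n + k) * m) x y = (Q n * m : ℕ)) :
    m * lowerIndicator β x y = expGrowthInf fun n => (Q n : ℝ≥0∞) := by
  have hmono : Monotone fun n => (waitingTime β n x y : ℝ≥0∞) := fun _ _ h =>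
    ENat.toENNReal_mono (waitingTime_mono β x y h)
  rw [← expGrowthInf_natCast_mul hm]
  refine (hmono.expGrowthInf_comp (tendsto_natCast_add_mul_div k m) (Nat.cast_ne_zero.2 hm)
    (EReal.natCast_ne_top m)).symm.trans (congrArg expGrowthInf (funext fun n => ?_))
  rw [Function.comp_apply, hW, ENat.toENNReal_coe]

theorem natCast_mul_upperIndicator (hm : m ≠ 0) {Q : ℕ → ℕ}
    (hW : ∀ n, waitingTime β ((n + k) * m) x y = (Q n * m : ℕ)) :
    m * upperIndicator β x y = expGrowthSup fun n => (Q n : ℝ≥0∞) := by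
  have hmono : Monotone fun n => (waitingTime β n x y : ℝ≥0∞) := fun _ _ h =>
    ENat.toENNReal_mono (waitingTime_mono β x y h)
  rw [← expGrowthSup_natCast_mul hm]
  refine (hmono.expGrowthSup_comp (tendsto_natCast_add_mul_div k m) (Nat.cast_ne_zero.2 hm)
    (EReal.natCast_ne_top m)).symm.trans (congrArg expGrowthSup (funext fun n => ?_))
  rw [Function.comp_apply, hW, ENat.toENNReal_coe]

theorem point_mem_waitingSet (hβ : 1 < β) {Q : ℕ → ℕ} {o : letters β m} {v w : ℕ → letters β m}
    (ho : (o : ℝ) = 0) (h : IsInsertion Q o v w) (hQ : StrictMono Q) (hQ0 : 0 < Q 0)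
    (ha : expGrowthInf (fun n => (Q n : ℝ≥0∞)) = m * a)
    (hb : expGrowthSup (fun n => (Q n : ℝ≥0∞)) = m * b) :
    (point v, point w) ∈ waitingSet β a b := by
  have hm : m ≠ 0 := (pos_of_letters hβ o).ne'
  have hW := h.waitingTime_eq hβ ho hQ hQ0
  have hcancel {c d : EReal} (hcd : m * c = m * d) : c = d := by
    rw [← EReal.mul_div_cancel (a := c) (EReal.natCast_ne_bot m) (EReal.natCast_ne_top m)
      (Nat.cast_ne_zero.2 hm), EReal.mul_div, hcd, ← EReal.mul_div,
      EReal.mul_div_cancel (EReal.natCast_ne_bot m) (EReal.natCast_ne_top m)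
      (Nat.cast_ne_zero.2 hm)]
  exact ⟨point_mem_Ico hβ v, point_mem_Ico hβ w,
    hcancel ((natCast_mul_lowerIndicator hm hW).trans ha),
    hcancel ((natCast_mul_upperIndicator hm hW).trans hb)⟩

end Growth

section Dimension

open scoped NNReal

theorem dimH_range_mul_le_of_dist_le {D X Y : Type*} [Nonempty D] [MetricSpace X] [MetricSpace Y]
    {G : D → X} {H : D → Y} {C r : ℝ≥0} (hr : 0 < r)
    (h : ∀ d d', dist (H d) (H d') ≤ C * dist (G d) (G d') ^ (r : ℝ)) :
    dimH (range H) * r ≤ dimH (range G) := by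
  set g : X → D := Function.invFun G
  have hGg : ∀ d, G (g (G d)) = G d := fun d => Function.invFun_eq ⟨d, rfl⟩
  have hHg : ∀ d, H (g (G d)) = H d := fun d => by
    refine dist_le_zero.1 ((h _ _).trans_eq ?_)
    rw [hGg, dist_self, Real.zero_rpow (NNReal.coe_ne_zero.2 hr.ne'), mul_zero]
  have hrange : (H ∘ g) '' range G = range H := by
    rw [← range_comp]
    exact congrArg range (funext hHg)
  rw [← hrange]
  refine (ENNReal.le_div_iff_mul_le (Or.inl (ENNReal.coe_ne_zero.2 hr.ne'))
    (Or.inl ENNReal.coe_ne_top)).1 (HolderOnWith.dimH_image_le (C := C) ?_ hr)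
  rintro _ ⟨d, rfl⟩ _ ⟨d', rfl⟩
  rw [Function.comp_apply, Function.comp_apply, hHg, hHg, edist_dist, edist_dist,
    ENNReal.ofReal_rpow_of_nonneg dist_nonneg r.coe_nonneg, ← ENNReal.ofReal_coe_nnreal,
    ← ENNReal.ofReal_mul C.coe_nonneg]
  exact ENNReal.ofReal_le_ofReal (h d d')

theorem dimH_range_ofDigits_prod {N : ℕ} (hN : 2 ≤ N) :
    dimH (range fun d : (ℕ → Fin N) × (ℕ → Fin N) =>
      (Real.ofDigits d.1, Real.ofDigits d.2)) = 2 := by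
  have hsub : Icc (0 : ℝ) 1 ×ˢ Icc (0 : ℝ) 1 ⊆ range fun d : (ℕ → Fin N) × (ℕ → Fin N) =>
      (Real.ofDigits d.1, Real.ofDigits d.2) := by
    rintro ⟨x, y⟩ ⟨hx, hy⟩
    obtain ⟨i, -, hi⟩ := Real.ofDigits_SurjOn hN hx
    obtain ⟨j, -, hj⟩ := Real.ofDigits_SurjOn hN hy
    exact ⟨(i, j), Prod.ext hi hj⟩
  have hinterior : (interior (Icc (0 : ℝ) 1 ×ˢ Icc (0 : ℝ) 1)).Nonempty := by
    rw [interior_prod_eq, interior_Icc]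
    exact (nonempty_Ioo.2 one_pos).prod (nonempty_Ioo.2 one_pos)
  rw [Real.dimH_of_nonempty_interior (hinterior.mono (interior_mono hsub)), Module.finrank_prod,
    Module.finrank_self]
  norm_num

theorem inv_pow_le_rpow {ρ δ s d N : ℝ} {q n : ℕ} (hρ : 0 < ρ) (hρ1 : ρ ≤ 1) (hδ : 0 < δ)
    (hs : 0 ≤ s) (hN : ρ ^ (-s) ≤ N) (hqn : s * q ≤ n) (hd : δ * ρ ^ q ≤ d) :
    (N ^ n)⁻¹ ≤ (δ ^ (s * s))⁻¹ * d ^ (s * s) := by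
  have hd0 : 0 ≤ d := le_trans (by positivity) hd
  calc (N ^ n)⁻¹ ≤ ((ρ ^ (-s)) ^ n)⁻¹ := by gcongr
    _ = ρ ^ (s * n) := by
      rw [← Real.rpow_mul_natCast hρ.le, ← Real.rpow_neg hρ.le, neg_mul, neg_neg]
    _ ≤ ρ ^ (s * (s * q)) := Real.rpow_le_rpow_of_exponent_ge hρ hρ1 (by gcongr)
    _ = (ρ ^ q) ^ (s * s) := by
      rw [← Real.rpow_natCast_mul hρ.le]
      congr 1
      ring
    _ ≤ (d / δ) ^ (s * s) := by
      gcongr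
      rwa [le_div_iff₀' hδ]
    _ = (δ ^ (s * s))⁻¹ * d ^ (s * s) := by
      rw [Real.div_rpow hd0 hδ.le, div_eq_inv_mul]

theorem abs_ofDigits_sub_le {N : ℕ} {i i' : ℕ → Fin N} {ρ δ s d : ℝ} (hρ : 0 < ρ)
    (hρ1 : ρ ≤ 1) (hδ : 0 < δ) (hs : 0 ≤ s) (hN : ρ ^ (-s) ≤ N) (hd : 0 ≤ d)
    (h : ∀ n, i n ≠ i' n → ∃ q : ℕ, s * q ≤ n ∧ δ * ρ ^ q ≤ d) :
    |Real.ofDigits i - Real.ofDigits i'| ≤ (δ ^ (s * s))⁻¹ * d ^ (s * s) := by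
  classical
  by_cases hex : ∃ n, i n ≠ i' n
  · obtain ⟨q, hqn, hq⟩ := h _ (Nat.find_spec hex)
    exact (Real.abs_ofDigits_sub_ofDigits_le fun k hk => not_not.1 (Nat.find_min hex hk)).trans
      (inv_pow_le_rpow hρ hρ1 hδ hs hN hqn hq)
  · push Not at hex
    rw [funext hex, sub_self, abs_zero]
    positivity

/-- The pair of points attached to two words over `Fin N`, when `f` codes the symbols by letters:
the second point has the letters `f ∘ d.2`, marked by `o`, and the first one has the letters
`f ∘ d.1` with the beginnings of the second one inserted at the places `Q n`. -/
def waitingPair {N : ℕ} (Q : ℕ → ℕ) (o t : letters β m) (f : Fin N → letters β m)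
    (d : (ℕ → Fin N) × (ℕ → Fin N)) : ℝ × ℝ :=
  (point (layout Q t (marked o (f ∘ d.2)) (f ∘ d.1)), point (marked o (f ∘ d.2)))

theorem dist_ofDigits_le (hβ : 1 < β) {N R : ℕ} {Q : ℕ → ℕ} {f : Fin N → letters β m}
    (hf : Function.Injective f) {s : ℝ} (hs : 0 ≤ s) (hs1 : s ≤ 1) (hN : (β ^ m) ^ s ≤ N)
    (hR2 : 2 ≤ R) (hRs : 1 ≤ R * (1 - s)) (hR : ∀ n, R * (n + 4) ^ 2 ≤ Q n) (o t : letters β m)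
    (d d' : (ℕ → Fin N) × (ℕ → Fin N)) :
    dist (Real.ofDigits d.1, Real.ofDigits d.2) (Real.ofDigits d'.1, Real.ofDigits d'.2) ≤
      (((1 - β⁻¹) * ((β ^ m)⁻¹) ^ 3) ^ (s * s))⁻¹ *
        dist (waitingPair Q o t f d) (waitingPair Q o t f d') ^ (s * s) := by
  have hρ : 0 < (β ^ m)⁻¹ := by positivity
  have hρ1 : (β ^ m)⁻¹ ≤ 1 := (inv_pow_lt_one_of_letters hβ o).le
  have hβ' : 0 < 1 - β⁻¹ := sub_pos.2 (inv_lt_one_of_one_lt₀ hβ)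
  have hNρ : ((β ^ m)⁻¹) ^ (-s) ≤ N := by
    rwa [Real.inv_rpow (by positivity), Real.rpow_neg (by positivity), inv_inv]
  rw [Prod.dist_eq]
  refine max_le ?_ ?_ <;>
    refine abs_ofDigits_sub_le hρ hρ1 (by positivity) hs hNρ dist_nonneg fun n hn => ?_
  · obtain ⟨q, hq, hne⟩ := exists_layout_ne (t := t) (w := marked o (f ∘ d.2)) (ξ := f ∘ d.1)
      (ξ' := f ∘ d'.1) hR2 hR (hf.ne hn) (marked o (f ∘ d'.2))
    refine ⟨q, ?_, ?_⟩
    · have hq' : (R : ℝ) * q ≤ R * n + q := by exact_mod_cast hq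
      have hRpos : (0 : ℝ) < R := by positivity
      refine le_of_mul_le_mul_left ?_ hRpos
      nlinarith [q.cast_nonneg (α := ℝ)]
    · calc (1 - β⁻¹) * ((β ^ m)⁻¹) ^ 3 * ((β ^ m)⁻¹) ^ q
          = (1 - β⁻¹) * ((β ^ m)⁻¹) ^ (q + 1) * ((β ^ m)⁻¹) ^ 2 := by ring
        _ ≤ (1 - β⁻¹) * ((β ^ m)⁻¹) ^ (q + 1) :=
          mul_le_of_le_one_right (by positivity) (pow_le_one₀ hρ.le hρ1)
        _ ≤ |(waitingPair Q o t f d).1 - (waitingPair Q o t f d').1| :=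
          mul_pow_le_abs_point_sub_point hβ hne
        _ ≤ _ := le_max_left _ _
  · have hne : marked o (f ∘ d.2) (n + 2) ≠ marked o (f ∘ d'.2) (n + 2) := hf.ne hn
    refine ⟨n, mul_le_of_le_one_left n.cast_nonneg hs1, ?_⟩
    calc (1 - β⁻¹) * ((β ^ m)⁻¹) ^ 3 * ((β ^ m)⁻¹) ^ n
        = (1 - β⁻¹) * ((β ^ m)⁻¹) ^ (n + 2 + 1) := by ring
      _ ≤ |(waitingPair Q o t f d).2 - (waitingPair Q o t f d').2| :=
        mul_pow_le_abs_point_sub_point hβ hne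
      _ ≤ _ := le_max_right _ _

theorem waitingPair_mem_waitingSet (hβ : 1 < β) {a b : EReal} (ha : 0 ≤ a) (hab : a ≤ b)
    {N R : ℕ} (hR : R ≠ 0) {o t : letters β m} (ho : (o : ℝ) = 0) (ht : t ≠ o)
    {f : Fin N → letters β m} (hfo : ∀ i, f i ≠ o) (hft : ∀ i, f i ≠ t)
    (d : (ℕ → Fin N) × (ℕ → Fin N)) :
    waitingPair (growthSeq R (m * a) (m * b)) o t f d ∈ waitingSet β a b := by
  have hma : 0 ≤ m * a := EReal.mul_nonneg m.cast_nonneg' ha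
  have hmab : m * a ≤ m * b := mul_le_mul_of_nonneg_left hab m.cast_nonneg'
  have hstep := growthSeq_add_le hR hma (hma.trans hmab)
  refine point_mem_waitingSet hβ ho (isInsertion_layout hstep (fun _ => hfo _) (fun _ => hfo _) ht
    fun _ => hft _) (strictMono_nat_of_lt_succ fun n => ?_) ?_ (expGrowthInf_growthSeq hR hma)
    (expGrowthSup_growthSeq hR hma hmab)
  · exact (Nat.lt_add_of_pos_right (by omega)).trans_le (hstep n)
  · exact (Nat.mul_pos (Nat.pos_of_ne_zero hR) (by norm_num)).trans_le (mul_sq_le_growthSeq R hma 0)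

theorem two_mul_le_dimH_waitingSet (hβ : 1 < β) {a b : EReal} (ha : 0 ≤ a) (hab : a ≤ b) {s : ℝ}
    (hs : 0 < s) (hs1 : s < 1) : 2 * ENNReal.ofReal (s * s) ≤ dimH (waitingSet β a b) := by
  obtain ⟨m, N, hN2, hN, e, he⟩ := exists_letters_embedding hβ hs.le hs1
  obtain ⟨R, hR⟩ := exists_nat_ge (max 2 (1 - s)⁻¹)
  have hR2 : 2 ≤ R := by exact_mod_cast (le_max_left _ _).trans hR
  have hRs : 1 ≤ R * (1 - s) :=
    (inv_le_iff_one_le_mul₀ (sub_pos.2 hs1)).1 ((le_max_right _ _).trans hR)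
  have hm : 0 < m := pos_of_letters hβ (e 0)
  set o : letters β m := ⟨0, zero_mem_letters hβ.le hm.ne'⟩
  have heo (i) : e i ≠ o := fun h => he i (congrArg Subtype.val h)
  set f : Fin N → letters β m := e ∘ Fin.castSucc
  have hf : Function.Injective f := e.injective.comp (Fin.castSucc_injective N)
  have hft (i) : f i ≠ e (Fin.last N) := e.injective.ne (Fin.castSucc_lt_last i).ne
  set Q := growthSeq R (m * a) (m * b)
  have hsub : range (waitingPair Q o (e (Fin.last N)) f) ⊆ waitingSet β a b :=
    range_subset_iff.2 (waitingPair_mem_waitingSet hβ ha hab (by omega) rfl (heo _)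
      (fun i => heo _) hft)
  have hQ := mul_sq_le_growthSeq (b := m * b) R (EReal.mul_nonneg m.cast_nonneg' ha)
  have hss : 0 < s * s := mul_pos hs hs
  have hnonempty : Nonempty (Fin N) := ⟨⟨0, by omega⟩⟩
  have hK : 0 ≤ (((1 - β⁻¹) * ((β ^ m)⁻¹) ^ 3) ^ (s * s))⁻¹ := by
    have : 0 ≤ 1 - β⁻¹ := sub_nonneg.2 (inv_le_one_of_one_le₀ hβ.le)
    positivity
  rw [← dimH_range_ofDigits_prod hN2, ENNReal.ofReal_eq_coe_nnreal hss.le]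
  exact (dimH_range_mul_le_of_dist_le (C := ⟨_, hK⟩) (r := ⟨s * s, hss.le⟩) hss
    (dist_ofDigits_le hβ hf hs.le hs1.le hN hR2 hRs hQ o (e (Fin.last N)))).trans (dimH_mono hsub)

end Dimension

end BetaWaiting

end

theorem theorem1 (β : ℝ) (hβ : 1 < β) (a b : EReal) (ha : 0 ≤ a) (hab : a ≤ b) :
    dimH (BetaWaiting.waitingSet β a b) = 2 := by
  refine le_antisymm ?_ ?_
  · calc dimH (BetaWaiting.waitingSet β a b) ≤ dimH (Set.univ : Set (ℝ × ℝ)) :=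
          dimH_mono (Set.subset_univ _)
      _ = 2 := by
        rw [Real.dimH_univ_eq_finrank, Module.finrank_prod, Module.finrank_self]
        norm_num
  · have hcont : Continuous fun s : ℝ => 2 * ENNReal.ofReal (s * s) :=
      (ENNReal.continuous_const_mul ENNReal.ofNat_ne_top).comp
        (ENNReal.continuous_ofReal.comp (continuous_id.mul continuous_id))
    have hlim : Filter.Tendsto (fun s : ℝ => 2 * ENNReal.ofReal (s * s)) (nhdsWithin 1 (Set.Iio 1))
        (nhds 2) := by
      simpa using (hcont.tendsto 1).mono_left nhdsWithin_le_nhds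
    refine le_of_tendsto hlim ?_
    filter_upwards [Ioo_mem_nhdsLT zero_lt_one] with s hs
    exact BetaWaiting.two_mul_le_dimH_waitingSet hβ ha hab hs.1 hs.2
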